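/- (i) Projectivity of modules over commutative rings ascends along flat ring homomorphisms and descends along faithfully flat ones: if $R\to S$ is a flat homomorphism of commutative rings and $M$ is a projective $R$-module, then $M\otimes_R S$ is a projective $S$-module; and if $R\to S$ is a faithfully flat homomorphism of commutative rings and $M$ is an $R$-module such that the $S$-module $M\otimes_R S$ is projective, then the $R$-module $M$ is projective. (Modules are not assumed finitely generated.) (ii) Call a quasi-coherent sheaf $\mathcal M$ on a scheme $X$ an (infinite-dimensional) vector bundle if for every affine open $U\subseteq X$ the $\mathcal O_X(U)$-module $\mathcal M(U)$ is projective. This notion is Zariski local on every scheme $X$: if $\mathcal M$ is a quasi-coherent sheaf on $X$ and $\mathcal C$ is any set of affine open subsets of $X$ with $\bigcup\mathcal C=X$, then $\mathcal M$ is a vector bundle if and only if the $\mathcal O_X(U)$-module $\mathcal M(U)$ is projective for every $U\in\mathcal C$. -/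

import Mathlib

universe u v w t

open scoped AlgebraicGeometry TensorProduct

/-- A sheaf of modules `M` on a scheme `X` is an (infinite-dimensional) vector bundle if it is
quasi-coherent and, for every affine open `U` of `X`, the `Γ(X, U)`-module of sections `Γ(M, U)`
is projective (not necessarily finitely generated). -/
def IsVectorBundle {X : AlgebraicGeometry.Scheme.{t}} (M : X.Modules) : Prop :=
  M.IsQuasicoherent ∧
    ∀ U : X.Opens, AlgebraicGeometry.IsAffineOpen U → Module.Projective Γ(X, U) Γ(M, U)

/-! Ascent is the base change of a retract of a free module. For descent, first let `M` be countably
generated, with `p : F → M` onto and `F` free of countable rank. Over `S` the map `p` splits, and by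
faithful flatness a finite linear system solvable over `S` is solvable over `R`. This gives
endomorphisms of `F` over `M` that kill given finite subsets of `ker p`, with a Mittag-Leffler type
stability. They are assembled into one `θ` with `p ∘ θ = p` that kills all of `ker p`, hence into a
section of `p` (`of_endomorphisms_over`).

A general `M` is reduced to this case by Kaplansky's dévissage. Since `S ⊗ M` is a retract of a free
module, submodules compatible with the retraction can be enlarged by countably many generators, and
the successive quotients are projective over `S`. By the countable case they are projective over
`R`, so partial sections of a free cover of `M` extend, and Zorn's lemma gives a full section.

For Zariski locality, the product of the localizations at finitely many elements generating the unit
ideal is faithfully flat, so descent applies; the affine communication lemma does the rest. -/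

/-! ### Descent for countably generated modules. -/

/-- Solvability of a system of linear equations for a linear map out of a free module descends
along faithfully flat algebras. -/
theorem Module.FaithfullyFlat.exists_linearMap_of_tensorProduct {R S A ι σ : Type*} [CommRing R]
    [CommRing S] [Algebra R S] [Module.FaithfullyFlat R S] [AddCommGroup A] [Module R A]
    [Finite σ] (x : σ → ι →₀ R) (y : σ → A) (φ : S ⊗[R] (ι →₀ R) →ₗ[R] S ⊗[R] A)
    (h : ∀ j, φ (1 ⊗ₜ x j) = 1 ⊗ₜ y j) :
    ∃ ψ : (ι →₀ R) →ₗ[R] A, ∀ j, ψ (x j) = y j := by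
  classical
  have := Fintype.ofFinite σ
  let Φ : (ι →₀ A) →ₗ[R] (σ → A) :=
    LinearMap.pi fun j ↦ Finsupp.lsum R fun i ↦ x j i • LinearMap.id
  have hΦ (i : ι) (a : A) : Φ (Finsupp.single i a) = ∑ j, x j i • Pi.single j a := by
    ext j
    simp [Φ, Finset.sum_apply, Pi.single_apply]
  let q := (LinearMap.range Φ).mkQ
  suffices y ∈ LinearMap.range Φ by
    obtain ⟨c, hc⟩ := this
    refine ⟨Finsupp.linearCombination R c, fun j ↦ ?_⟩
    rw [← hc, Finsupp.linearCombination_apply]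
    simp only [Φ, LinearMap.pi_apply, Finsupp.lsum_apply]
    rw [Finsupp.sum_of_support_subset _ (Finset.subset_union_left (s₂ := c.support)) _ (by simp),
      Finsupp.sum_of_support_subset _ (Finset.subset_union_right (s₁ := (x j).support)) _
      (by simp)]
    rfl
  rw [← Submodule.Quotient.mk_eq_zero]
  change q y = 0
  rw [← Module.FaithfullyFlat.one_tmul_eq_zero_iff R _ (A := S)]
  -- The class `1 ⊗ q y` is `∑ j, G j (x j)`. Expanded in the basis, its `i`-th term vanishes
  -- because `∑ j, x j i • Pi.single j a` lies in the range of `Φ`.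
  let G (j : σ) : (ι →₀ R) →ₗ[R] S ⊗[R] ((σ → A) ⧸ LinearMap.range Φ) :=
    LinearMap.lTensor S (q ∘ₗ LinearMap.single R (fun _ ↦ A) j) ∘ₗ φ ∘ₗ
      TensorProduct.mk R S (ι →₀ R) 1
  have hG (j : σ) : G j (x j) = 1 ⊗ₜ q (Pi.single j (y j)) := by simp [G, h]
  have hsum : (1 : S) ⊗ₜ[R] q y = ∑ j, G j (x j) := by
    simp_rw [hG, ← TensorProduct.tmul_sum, ← map_sum, Finset.univ_sum_single]
  have hzero (i : ι) : ∑ j, x j i • G j (Finsupp.single i 1) = 0 := by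
    have hcomp : ∑ j, x j i • (q ∘ₗ LinearMap.single R (fun _ ↦ A) j) = 0 := by
      ext a
      have : q (Φ (Finsupp.single i a)) = 0 := by simp [q]
      simpa [hΦ] using this
    have := congr(LinearMap.lTensor S $hcomp (φ (1 ⊗ₜ Finsupp.single i 1)))
    simp only [← LinearMap.coe_lTensorHom, map_sum, map_smul, LinearMap.sum_apply, map_zero,
      LinearMap.smul_apply, LinearMap.zero_apply] at this
    exact this
  rw [hsum]
  let s : Finset ι := Finset.univ.biUnion fun j ↦ (x j).support
  have hx (j : σ) : G j (x j) = ∑ i ∈ s, x j i • G j (Finsupp.single i 1) := by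
    conv_lhs => rw [← Finsupp.sum_single (x j)]
    rw [Finsupp.sum_of_support_subset (s := s) _
      (Finset.subset_biUnion_of_mem (fun j ↦ (x j).support) (Finset.mem_univ j)) _ (by simp),
      map_sum]
    refine Finset.sum_congr rfl fun i _ ↦ ?_
    rw [← map_smul, Finsupp.smul_single_one]
  simp_rw [hx]
  rw [Finset.sum_comm]
  exact Finset.sum_eq_zero fun i _ ↦ hzero i

/-- A criterion for projectivity of a countably generated module `M`, in terms of the
endomorphisms over `M` of a free module mapping onto `M`. -/
theorem Module.Projective.of_endomorphisms_over {R M : Type*} [CommRing R] [AddCommGroup M]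
    [Module R M] (p : (ℕ →₀ R) →ₗ[R] M) (hp : Function.Surjective p)
    (hker : ∀ k, p k = 0 → ∃ v : Module.End R (ℕ →₀ R), p ∘ₗ v = p ∧ v k = 0)
    (hstab : ∀ s : Finset (ℕ →₀ R), ∃ v : Module.End R (ℕ →₀ R), p ∘ₗ v = p ∧
      ∀ v' : Module.End R (ℕ →₀ R), p ∘ₗ v' = p →
        ∃ τ : Module.End R (ℕ →₀ R), ∀ x ∈ s, τ (v' (v x)) = v x) :
    Module.Projective R M := by
  classical
  let e (i : ℕ) : ℕ →₀ R := Finsupp.single i 1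
  -- For `d = (u, w)`: no endomorphism over `M` loses information on `u (e i)`, `i < n`, as some `τ`
  -- recovers it. The approximation to `θ` at stage `n` is `w ∘ u`.
  let Good (n : ℕ) (d : Module.End R (ℕ →₀ R) × Module.End R (ℕ →₀ R)) : Prop :=
    p ∘ₗ d.1 = p ∧ p ∘ₗ d.2 = p ∧ ∀ v' : Module.End R (ℕ →₀ R), p ∘ₗ v' = p →
      ∃ τ : Module.End R (ℕ →₀ R), ∀ i < n, τ (v' (d.1 (e i))) = d.1 (e i)
  have step (n : ℕ) (d) (hd : Good n d) : ∃ d', Good (n + 1) d' ∧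
      ∀ i < n, d'.2 (d'.1 (e i)) = d.2 (d.1 (e i)) := by
    obtain ⟨h1, h2, h3⟩ := hd
    obtain ⟨v, hv, hvs⟩ := hstab ((Finset.range (n + 1)).image fun i ↦ d.1 (e i))
    obtain ⟨τ, hτ⟩ := h3 v hv
    -- For `i < n`, `τ` sends `v (u (e i))` to `u (e i)`, so the new composite there is `v u - (v -
    -- w) u = w u`: earlier values are unchanged.
    refine ⟨(v ∘ₗ d.1, LinearMap.id - (v - d.2) ∘ₗ τ), ⟨?_, ?_, ?_⟩, ?_⟩
    · rw [← LinearMap.comp_assoc, hv, h1]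
    · rw [LinearMap.comp_sub, ← LinearMap.comp_assoc, LinearMap.comp_sub, hv, h2]
      simp
    · intro v' hv'
      obtain ⟨τ', h⟩ := hvs v' hv'
      refine ⟨τ', fun i hi ↦ h _ ?_⟩
      exact Finset.mem_image_of_mem (fun i ↦ d.1 (e i)) (Finset.mem_range.mpr hi)
    · intro i hi
      simp [hτ i hi]
  let seq (n : ℕ) : {d // Good n d} :=
    Nat.rec ⟨(LinearMap.id, LinearMap.id), by simp [Good]⟩
      (fun n d ↦ ⟨(step n d.1 d.2).choose, (step n d.1 d.2).choose_spec.1⟩) n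
  let g (n : ℕ) : Module.End R (ℕ →₀ R) := (seq n).1.2 ∘ₗ (seq n).1.1
  have hg (n i : ℕ) (hi : i < n) : g (n + 1) (e i) = g n (e i) :=
    (step n (seq n).1 (seq n).2).choose_spec.2 i hi
  have hgi (i n : ℕ) (hi : i + 1 ≤ n) : g n (e i) = g (i + 1) (e i) := by
    induction n, hi using Nat.le_induction with
    | base => rfl
    | succ n hn ih => rw [hg n i hn, ih]
  have hpg (n : ℕ) : p ∘ₗ g n = p := by
    rw [← LinearMap.comp_assoc, (seq n).2.2.1, (seq n).2.1]
  let θ : Module.End R (ℕ →₀ R) := Finsupp.linearCombination R fun i ↦ g (i + 1) (e i)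
  have hpθ : p ∘ₗ θ = p := by
    ext i
    simpa [θ, e] using LinearMap.congr_fun (hpg (i + 1)) (e i)
  have eqOn {φ ψ : Module.End R (ℕ →₀ R)} (k : ℕ →₀ R) {n : ℕ} (hn : ∀ i ∈ k.support, i < n)
      (h : ∀ i < n, φ (e i) = ψ (e i)) : φ k = ψ k := by
    rw [← Finsupp.sum_single k, Finsupp.sum, map_sum, map_sum]
    refine Finset.sum_congr rfl fun i hi ↦ ?_
    rw [← Finsupp.smul_single_one, map_smul, map_smul]
    exact congr(_ • $(h i (hn i hi)))
  have hθ : LinearMap.ker p ≤ LinearMap.ker θ := by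
    intro k hk
    obtain ⟨n, hn⟩ : ∃ n, ∀ i ∈ k.support, i < n :=
      ⟨k.support.sup id + 1, fun i hi ↦ Nat.lt_succ_of_le (Finset.le_sup (f := id) hi)⟩
    have h1 : θ k = g n k := eqOn k hn fun i hi ↦ by simp [θ, e, ← hgi i n hi]
    -- Some `v'` over `M` kills `u k`, where `u` is the first map at stage `n`, yet `τ ∘ v'` fixes
    -- `u k`; hence `u k = 0`.
    obtain ⟨v', hv', hv0⟩ := hker ((seq n).1.1 k) <| by
      have := LinearMap.congr_fun (seq n).2.1 k
      rw [LinearMap.comp_apply] at this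
      rw [this]
      exact hk
    obtain ⟨τ, hτ⟩ := (seq n).2.2.2 v' hv'
    have h2 : (τ ∘ₗ v' ∘ₗ (seq n).1.1) k = (seq n).1.1 k := eqOn k hn hτ
    have h3 : (seq n).1.1 k = 0 := by simpa [hv0] using h2.symm
    rw [LinearMap.mem_ker, h1]
    simp [g, h3]
  refine Module.Projective.of_split
    ((LinearMap.ker p).liftQ θ hθ ∘ₗ (p.quotKerEquivOfSurjective hp).symm.toLinearMap) p ?_
  ext m
  obtain ⟨x, rfl⟩ := hp m
  have : (p.quotKerEquivOfSurjective hp).symm (p x) = (LinearMap.ker p).mkQ x :=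
    (LinearEquiv.symm_apply_eq _).mpr rfl
  simpa [this] using LinearMap.congr_fun hpθ x

/-- An element of `S ⊗ K` involves only finitely many elements of `K`. -/
theorem TensorProduct.exists_finset_forall_lTensor_eq_zero {R S K N : Type*} [CommRing R]
    [AddCommGroup S] [Module R S] [AddCommGroup K] [Module R K] [AddCommGroup N] [Module R N]
    (w : S ⊗[R] K) :
    ∃ T : Finset K, ∀ v : K →ₗ[R] N, (∀ k ∈ T, v k = 0) → LinearMap.lTensor S v w = 0 := by
  classical
  induction w with
  | zero => exact ⟨∅, by simp⟩
  | tmul s k => exact ⟨{k}, fun v hv ↦ by simp [hv k (Finset.mem_singleton_self k)]⟩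
  | add a b ha hb =>
    obtain ⟨T, hT⟩ := ha
    obtain ⟨T', hT'⟩ := hb
    refine ⟨T ∪ T', fun v hv ↦ ?_⟩
    rw [map_add, hT v fun k hk ↦ hv k (Finset.mem_union_left _ hk),
      hT' v fun k hk ↦ hv k (Finset.mem_union_right _ hk), add_zero]

/-- If `M` becomes projective over a flat algebra `S`, then the base change to `S` of an exact
sequence `0 ⟶ ker p ⟶ F ⟶ M ⟶ 0` splits. -/
theorem Module.Projective.exists_splitting_lTensor {R S F M : Type*} [CommRing R]
    [CommRing S] [Algebra R S] [Module.Flat R S] [AddCommGroup F] [Module R F] [AddCommGroup M]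
    [Module R M] [Module.Projective S (S ⊗[R] M)] (p : F →ₗ[R] M) (hp : Function.Surjective p) :
    ∃ (s : S ⊗[R] M →ₗ[R] S ⊗[R] F) (t : S ⊗[R] F →ₗ[R] S ⊗[R] LinearMap.ker p),
      ∀ z, (LinearMap.ker p).subtype.lTensor S (t z) = z - s (p.lTensor S z) := by
  have hpS : Function.Surjective (p.lTensor S) := LinearMap.lTensor_surjective S hp
  obtain ⟨s', hs'⟩ := (p.baseChange S).exists_rightInverse_of_surjective
    (LinearMap.range_eq_top.mpr hpS)
  have hs (z) : p.lTensor S (s'.restrictScalars R z) = z := LinearMap.congr_fun hs' z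
  generalize s'.restrictScalars R = s at hs
  have hj := Module.Flat.lTensor_preserves_injective_linearMap (M := S) _
    (LinearMap.ker p).injective_subtype
  have hrange := (LinearMap.exact_iff.mp
    (lTensor_exact S (LinearMap.exact_subtype_ker_map p) hp)).symm
  have hmem (z) : (LinearMap.id - s ∘ₗ p.lTensor S : _ →ₗ[R] _) z ∈
      LinearMap.range ((LinearMap.ker p).subtype.lTensor S) := by
    rw [hrange]
    simp [hs]
  refine ⟨s, (LinearEquiv.ofInjective _ hj).symm.toLinearMap ∘ₗ
    LinearMap.codRestrict _ _ hmem, fun z ↦ ?_⟩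
  exact congr_arg Subtype.val ((LinearEquiv.ofInjective _ hj).apply_symm_apply
    (LinearMap.codRestrict _ _ hmem z))

/-- Faithfully flat descent of projectivity for countably generated modules. -/
theorem Module.Projective.of_tensorProduct_of_span_range {R S M : Type*} [CommRing R]
    [CommRing S] [Algebra R S] [Module.FaithfullyFlat R S] [AddCommGroup M] [Module R M]
    (f : ℕ → M) (hf : Submodule.span R (Set.range f) = ⊤)
    (h : Module.Projective S (S ⊗[R] M)) : Module.Projective R M := by
  classical
  obtain ⟨p, hp⟩ : ∃ p : (ℕ →₀ R) →ₗ[R] M, Function.Surjective p :=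
    ⟨Finsupp.linearCombination R f, by
      rw [← LinearMap.range_eq_top, Finsupp.range_linearCombination, hf]⟩
  obtain ⟨s, t, ht⟩ := exists_splitting_lTensor (S := S) p hp
  have hj := Module.Flat.lTensor_preserves_injective_linearMap (M := S) _
    (LinearMap.ker p).injective_subtype
  -- Over `S` the projection `t` fixes the kernel. Descending its values on `T` gives `ψ : F → ker
  -- p` fixing `T`, and `v = id - ψ`.
  have hkill (T : Finset (LinearMap.ker p)) : ∃ v : Module.End R (ℕ →₀ R), p ∘ₗ v = p ∧
      ∀ k ∈ T, v (k : ℕ →₀ R) = 0 := by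
    obtain ⟨ψ, hψ⟩ := Module.FaithfullyFlat.exists_linearMap_of_tensorProduct (S := S)
      (fun k : T ↦ (k.1 : ℕ →₀ R)) (fun k : T ↦ k.1) t fun k ↦ hj <| by
        rw [ht, LinearMap.lTensor_tmul, LinearMap.lTensor_tmul, k.1.2]
        simp
    refine ⟨LinearMap.id - (LinearMap.ker p).subtype ∘ₗ ψ, ?_, fun k hk ↦ ?_⟩
    · ext i
      have : p (ψ (Finsupp.single i 1) : ℕ →₀ R) = 0 := (ψ (Finsupp.single i 1)).2
      simp [this]
    · simp [hψ ⟨k, hk⟩]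
  refine .of_endomorphisms_over p hp (fun k hk ↦ ?_) fun F ↦ ?_
  · obtain ⟨v, hv, hv0⟩ := hkill {⟨k, hk⟩}
    exact ⟨v, hv, hv0 ⟨k, hk⟩ (Finset.mem_singleton_self _)⟩
  -- Choose `v` to kill the kernel elements occurring in `t (1 ⊗ x)`. Then `1 ⊗ v x` depends only on
  -- `p x`, which `v' ∘ v` preserves, so `v x` is recovered from `v' (v x)` over `S`, hence over
  -- `R`.
  · choose T hT using fun x : ℕ →₀ R ↦
      TensorProduct.exists_finset_forall_lTensor_eq_zero (N := ℕ →₀ R) (t (1 ⊗ₜ x))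
    obtain ⟨v, hv, hvT⟩ := hkill (F.biUnion T)
    refine ⟨v, hv, fun v' hv' ↦ ?_⟩
    have hve (x) (hx : x ∈ F) :
        LinearMap.lTensor S v (s (p.lTensor S (1 ⊗ₜ x))) = 1 ⊗ₜ v x := by
      have h0 := hT x (v ∘ₗ (LinearMap.ker p).subtype) fun k hk ↦
        hvT k (Finset.mem_biUnion.mpr ⟨x, hx, hk⟩)
      rw [LinearMap.lTensor_comp, LinearMap.comp_apply, ht, map_sub, sub_eq_zero] at h0
      rw [← h0, LinearMap.lTensor_tmul]
    obtain ⟨τ, hτ⟩ := Module.FaithfullyFlat.exists_linearMap_of_tensorProduct (S := S)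
      (fun x : F ↦ v' (v x)) (fun x : F ↦ v x) (LinearMap.lTensor S v ∘ₗ s ∘ₗ p.lTensor S)
      fun x ↦ by
        have : p (v' (v x)) = p x :=
          (LinearMap.congr_fun hv' (v x)).trans (LinearMap.congr_fun hv x)
        rw [← hve x x.2, LinearMap.comp_apply, LinearMap.comp_apply, LinearMap.lTensor_tmul,
          LinearMap.lTensor_tmul, this]
    exact ⟨τ, fun x hx ↦ hτ ⟨x, hx⟩⟩

/-! ### Kaplansky dévissage to countably generated quotients. -/

/-- The closure of a point under a countable-valued relation is countable. -/
theorem Set.exists_countable_closed {α : Type*} (γ : α → Set α) (hγ : ∀ a, (γ a).Countable)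
    (a : α) : ∃ T : Set α, T.Countable ∧ a ∈ T ∧ ∀ x ∈ T, γ x ⊆ T := by
  let step (X : Set α) : Set α := ⋃ x ∈ X, γ x
  refine ⟨⋃ n, step^[n] {a}, Set.countable_iUnion fun n ↦ ?_,
    Set.mem_iUnion.mpr ⟨0, rfl⟩, fun x hx y hy ↦ ?_⟩
  · induction n with
    | zero => exact Set.countable_singleton a
    | succ n ih =>
      rw [Function.iterate_succ_apply']
      exact ih.biUnion fun x _ ↦ hγ x
  · obtain ⟨n, hn⟩ := Set.mem_iUnion.mp hx
    refine Set.mem_iUnion.mpr ⟨n + 1, ?_⟩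
    rw [Function.iterate_succ_apply']
    exact Set.mem_biUnion hn hy

theorem TensorProduct.exists_finset_mem_baseChange_span {R S M : Type*} [CommRing R] [CommRing S]
    [Algebra R S] [AddCommGroup M] [Module R M] (z : S ⊗[R] M) :
    ∃ T : Finset M, z ∈ (Submodule.span R (T : Set M)).baseChange S := by
  classical
  induction z with
  | zero => exact ⟨∅, Submodule.zero_mem _⟩
  | tmul s m =>
    exact ⟨{m}, Submodule.tmul_mem_baseChange_of_mem s (Submodule.subset_span (by simp))⟩
  | add a b ha hb =>
    obtain ⟨T, hT⟩ := ha
    obtain ⟨T', hT'⟩ := hb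
    refine ⟨T ∪ T', Submodule.add_mem _ (Submodule.baseChange_mono _ ?_ hT)
      (Submodule.baseChange_mono _ ?_ hT')⟩ <;>
    exact Submodule.span_mono (by simp)

section Adapted

variable {R S M I : Type*} [CommRing R] [CommRing S] [Algebra R S] [AddCommGroup M] [Module R M]

/-- Let `S ⊗ M` be a retract of the free module on `I`. A submodule `N` of `M` and a subset `J`
of `I` are adapted to each other if the retraction restricts to maps between the image of `S ⊗ N`
and the free module on `J`. -/
structure IsAdapted (i : S ⊗[R] M →ₗ[S] I →₀ S) (r : (I →₀ S) →ₗ[S] S ⊗[R] M)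
    (N : Submodule R M) (J : Set I) : Prop where
  mem_supported : ∀ x ∈ N, i (1 ⊗ₜ x) ∈ Finsupp.supported S S J
  mem_baseChange : ∀ j ∈ J, r (Finsupp.single j 1) ∈ N.baseChange S

variable {i : S ⊗[R] M →ₗ[S] I →₀ S} {r : (I →₀ S) →ₗ[S] S ⊗[R] M} {N N' : Submodule R M}
  {J J' : Set I}

/-- Each `i (1 ⊗ x)` has finite support and each `r (e_j)` involves finitely many elements of `M`,
so closing up `m` under both operations adds only countably much. -/
theorem IsAdapted.exists_countable_extension (h : IsAdapted i r N J) (m : M) :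
    ∃ (c : Set M) (J' : Set I), c.Countable ∧ m ∈ c ∧ J ⊆ J' ∧
      IsAdapted i r (N ⊔ Submodule.span R c) J' := by
  choose A hA using fun j : I ↦
    TensorProduct.exists_finset_mem_baseChange_span (r (Finsupp.single j 1))
  let γ : M ⊕ I → Set (M ⊕ I) :=
    Sum.elim (fun x ↦ Sum.inr '' ((i (1 ⊗ₜ x)).support : Set I)) fun j ↦ Sum.inl '' (A j : Set M)
  obtain ⟨T, hTc, hmT, hT⟩ := Set.exists_countable_closed γ (by
    rintro (x | j)
    · exact ((Finset.countable_toSet _).image _)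
    · exact ((Finset.countable_toSet _).image _)) (Sum.inl m)
  have hinl {x : M} (hx : Sum.inl x ∈ T) : i (1 ⊗ₜ x) ∈ Finsupp.supported S S (Sum.inr ⁻¹' T) := by
    rw [Finsupp.mem_supported]
    exact fun j hj ↦ hT _ hx ⟨j, hj, rfl⟩
  have hinr {j : I} (hj : Sum.inr j ∈ T) : (A j : Set M) ⊆ Sum.inl ⁻¹' T :=
    fun x hx ↦ hT _ hj ⟨x, hx, rfl⟩
  refine ⟨Sum.inl ⁻¹' T, J ∪ Sum.inr ⁻¹' T, hTc.preimage Sum.inl_injective, hmT,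
    Set.subset_union_left, ⟨?_, ?_⟩⟩
  · let P : Submodule R M := ((Finsupp.supported S S (J ∪ Sum.inr ⁻¹' T)).restrictScalars R).comap
      (i.restrictScalars R ∘ₗ TensorProduct.mk R S M 1)
    suffices N ⊔ Submodule.span R (Sum.inl ⁻¹' T) ≤ P from fun x hx ↦ this hx
    refine sup_le (fun x hx ↦ ?_) (Submodule.span_le.mpr fun x hx ↦ ?_)
    · exact Finsupp.supported_mono Set.subset_union_left (h.mem_supported x hx)
    · exact Finsupp.supported_mono Set.subset_union_right (hinl hx)
  · rintro j (hj | hj)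
    · exact Submodule.baseChange_mono _ le_sup_left (h.mem_baseChange j hj)
    · exact Submodule.baseChange_mono _
        (le_trans (Submodule.span_mono (hinr hj)) le_sup_right) (hA j)

/-- The map `i` modulo the coordinates in `J` is defined on `S ⊗ (N' / N)`, and `r` induces a
retraction of it. Flatness embeds `S ⊗ N'` in `S ⊗ M`, so the values of `r` lift uniquely. -/
theorem IsAdapted.projective_quotient [Module.Flat R S] (hri : r ∘ₗ i = LinearMap.id)
    (h : IsAdapted i r N J) (h' : IsAdapted i r N' J') (hN : N ≤ N') :
    Module.Projective S (S ⊗[R] (N' ⧸ N.submoduleOf N')) := by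
  classical
  let π : S ⊗[R] N' →ₗ[S] S ⊗[R] (N' ⧸ N.submoduleOf N') :=
    (N.submoduleOf N').mkQ.baseChange S
  let ε : S ⊗[R] N' →ₗ[S] S ⊗[R] M := N'.subtype.baseChange S
  have hε : Function.Injective ε :=
    Module.Flat.lTensor_preserves_injective_linearMap _ N'.injective_subtype
  choose! z hz using h'.mem_baseChange
  change ∀ j ∈ J', ε (z j) = _ at hz
  -- Indices in `J` give zero because `r (e_j)` comes from `S ⊗ N`; indices outside `J'` never occur
  -- in `i (1 ⊗ x)` for `x ∈ N'`.
  let c (j : I) : S ⊗[R] (N' ⧸ N.submoduleOf N') := if j ∈ J' ∧ j ∉ J then π (z j) else 0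
  have hc (j : I) (hj : j ∈ J') : c j = π (z j) := by
    by_cases hjJ : j ∈ J
    · obtain ⟨y, hy⟩ := h.mem_baseChange j hjJ
      have : z j = (Submodule.inclusion hN).baseChange S y := hε <| by
        rw [hz j hj, ← hy, ← LinearMap.comp_apply, ← LinearMap.baseChange_comp]
        rfl
      have hzero : (N.submoduleOf N').mkQ ∘ₗ Submodule.inclusion hN = 0 := by
        ext x
        exact (Submodule.Quotient.mk_eq_zero _).mpr x.2
      simp only [c, hjJ, not_true_eq_false, and_false, if_false, this, π]
      rw [← LinearMap.comp_apply, ← LinearMap.baseChange_comp, hzero]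
      simp
    · simp [c, hj, hjJ]
  let ρ : (I →₀ S) →ₗ[S] S ⊗[R] (N' ⧸ N.submoduleOf N') := Finsupp.linearCombination S c
  have hρ (f : I →₀ S) (hf : f ∈ Finsupp.supported S S J') (y : S ⊗[R] N') (hy : ε y = r f) :
      ρ f = π y := by
    rw [Finsupp.mem_supported] at hf
    have hy' : y = ∑ j ∈ f.support, f j • z j := hε <| by
      rw [hy, map_sum]
      conv_lhs => rw [← Finsupp.sum_single f, Finsupp.sum, map_sum]
      refine Finset.sum_congr rfl fun j hj ↦ ?_
      rw [map_smul, hz j (hf hj), ← map_smul, Finsupp.smul_single_one]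
    rw [hy', map_sum]
    refine Finset.sum_congr rfl fun j hj ↦ ?_
    simp [hc j (hf hj)]
  let α : N' →ₗ[R] (↥(Jᶜ) →₀ S) :=
    (Finsupp.lsubtypeDomain (M := S) (R := S) Jᶜ).restrictScalars R ∘ₗ
      i.restrictScalars R ∘ₗ TensorProduct.mk R S M 1 ∘ₗ N'.subtype
  have hα : N.submoduleOf N' ≤ LinearMap.ker α := by
    intro x hx
    have hsupp := h.mem_supported x hx
    rw [Finsupp.mem_supported'] at hsupp
    exact Finsupp.ext fun j ↦ hsupp _ j.2
  let ρ' : (↥(Jᶜ) →₀ S) →ₗ[S] S ⊗[R] (N' ⧸ N.submoduleOf N') :=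
    Finsupp.linearCombination S fun j ↦ c j
  have hρ' : ρ' ∘ₗ Finsupp.lsubtypeDomain (R := S) Jᶜ = ρ := by
    refine Finsupp.lhom_ext fun j s ↦ ?_
    by_cases hj : j ∈ J
    · have : Finsupp.lsubtypeDomain (R := S) Jᶜ (Finsupp.single j s) = 0 := by
        ext k
        have : j ≠ k := fun e ↦ k.2 (e ▸ hj)
        change Finsupp.single j s k = 0
        simp [this]
      simp [this, ρ, c, hj]
    · have : Finsupp.lsubtypeDomain (R := S) Jᶜ (Finsupp.single j s) =
          Finsupp.single ⟨j, hj⟩ s := by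
        ext k
        change Finsupp.single j s k = _
        simp [Finsupp.single_apply, Subtype.ext_iff]
      simp [this, ρ, ρ']
  refine .of_split (((N.submoduleOf N').liftQ α hα).liftBaseChange S) ρ' ?_
  ext x
  have := hρ (i (1 ⊗ₜ (x : M))) (h'.mem_supported x x.2) (1 ⊗ₜ x)
    (LinearMap.congr_fun hri (1 ⊗ₜ (x : M))).symm
  rw [← hρ'] at this
  simpa [α, π] using this

end Adapted

/-- A partial section of `p` extends along an inclusion of submodules with projective quotient. -/
theorem Module.Projective.exists_linearPMap_extension {R F M : Type*} [CommRing R] [AddCommGroup F]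
    [Module R F] [AddCommGroup M] [Module R M] (p : F →ₗ[R] M) (hp : Function.Surjective p)
    (f : M →ₗ.[R] F) (hf : ∀ x, p (f x) = x) {N' : Submodule R M} (hN : f.domain ≤ N')
    (h : Module.Projective R (N' ⧸ f.domain.submoduleOf N')) :
    ∃ f' : M →ₗ.[R] F, f'.domain = N' ∧ f ≤ f' ∧ ∀ x, p (f' x) = x := by
  let q := (f.domain.submoduleOf N').mkQ
  -- Split `q` by `σ` and lift `σ` through `p` to `g`. The extension applies `f` to `y - σ (q y)`,
  -- which lies in its domain, and adds `g (q y)`.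
  obtain ⟨σ, hσ⟩ := Module.projective_lifting_property q LinearMap.id
    (Submodule.mkQ_surjective _)
  obtain ⟨g, hg⟩ := Module.projective_lifting_property p (N'.subtype ∘ₗ σ) hp
  have hmem (y : N') : N'.subtype (y - σ (q y)) ∈ f.domain := by
    have : q (y - σ (q y)) = 0 := by
      rw [map_sub, sub_eq_zero]
      exact (LinearMap.congr_fun hσ (q y)).symm
    exact (Submodule.Quotient.mk_eq_zero (f.domain.submoduleOf N')).mp this
  let f' : N' →ₗ[R] F := f.toFun ∘ₗ LinearMap.codRestrict f.domain
    (N'.subtype ∘ₗ (LinearMap.id - σ ∘ₗ q)) hmem + g ∘ₗ q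
  have hf' (y : N') : f' y = f ⟨_, hmem y⟩ + g (q y) := rfl
  have hgσ (y : N') : p (g (q y)) = (σ (q y) : M) := LinearMap.congr_fun hg (q y)
  refine ⟨⟨N', f'⟩, rfl, ⟨hN, fun x y hxy ↦ ?_⟩, fun y ↦ ?_⟩
  · have hq : q y = 0 := (Submodule.Quotient.mk_eq_zero _).mpr <| by
      change (y : M) ∈ f.domain
      exact hxy ▸ x.2
    change f x = f' y
    have hx : x = ⟨_, hmem y⟩ := Subtype.ext (by simp [hq, hxy])
    rw [hf', ← hx, hq, map_zero, add_zero]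
  · change p (f' y) = y
    rw [hf', map_add, hf, hgσ]
    simp

/-- Faithfully flat descent of projectivity (Raynaud–Gruson). -/
theorem Module.Projective.of_tensorProduct_of_faithfullyFlat {R S M : Type*} [CommRing R]
    [CommRing S] [Algebra R S] [Module.FaithfullyFlat R S] [AddCommGroup M] [Module R M]
    (h : Module.Projective S (S ⊗[R] M)) : Module.Projective R M := by
  obtain ⟨i, hi⟩ := Module.projective_def'.mp h
  generalize Finsupp.linearCombination S (id : S ⊗[R] M → S ⊗[R] M) = r at hi
  obtain ⟨p, hp⟩ : ∃ p : (M →₀ R) →ₗ[R] M, Function.Surjective p :=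
    ⟨_, Finsupp.linearCombination_id_surjective R M⟩
  -- The index set `J` is carried along with the partial section, so that adaptedness passes to
  -- unions of chains.
  let 𝒮 : Set ((M →ₗ.[R] (M →₀ R)) × Set (S ⊗[R] M)) :=
    {d | (∀ x, p (d.1 x) = x) ∧ IsAdapted i r d.1.domain d.2}
  obtain ⟨⟨f, J⟩, -, ⟨hf, hfJ⟩, hmax⟩ := zorn_le_nonempty₀ 𝒮 (fun c hcS hc d₀ hd₀ ↦ by
    have hdir : DirectedOn (· ≤ ·) (Prod.fst '' c) := by
      rintro _ ⟨d, hd, rfl⟩ _ ⟨e, he, rfl⟩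
      obtain h | h := hc.total hd he
      · exact ⟨_, Set.mem_image_of_mem _ he, h.1, le_rfl⟩
      · exact ⟨_, Set.mem_image_of_mem _ hd, le_rfl, h.1⟩
    have hne : (Prod.fst '' c).Nonempty := ⟨_, Set.mem_image_of_mem _ hd₀⟩
    refine ⟨(LinearPMap.sSup _ hdir, ⋃ d ∈ c, d.2), ⟨?_, ?_, ?_⟩, fun d hd ↦
      ⟨LinearPMap.le_sSup hdir (Set.mem_image_of_mem _ hd), Set.subset_biUnion_of_mem hd⟩⟩
    · rintro ⟨x, hx⟩
      obtain ⟨_, ⟨d, hd, rfl⟩, hxd⟩ := (LinearPMap.mem_domain_sSup_iff hne hdir).mp hx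
      have := LinearPMap.sSup_apply hdir (Set.mem_image_of_mem _ hd) ⟨x, hxd⟩
      exact (congrArg p this).trans ((hcS hd).1 ⟨x, hxd⟩)
    · intro x hx
      obtain ⟨_, ⟨d, hd, rfl⟩, hxd⟩ := (LinearPMap.mem_domain_sSup_iff hne hdir).mp hx
      exact Finsupp.supported_mono (Set.subset_biUnion_of_mem (u := Prod.snd) hd)
        ((hcS hd).2.mem_supported x hxd)
    · intro j hj
      obtain ⟨d, hd, hj⟩ := Set.mem_iUnion₂.mp hj
      exact Submodule.baseChange_mono _
        (LinearPMap.le_sSup hdir (Set.mem_image_of_mem _ hd)).1 ((hcS hd).2.mem_baseChange j hj))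
    (⊥, ∅) ⟨by rintro ⟨x, hx⟩; obtain rfl := (Submodule.mem_bot R).mp hx; exact map_zero p, by
      intro x hx; obtain rfl := (Submodule.mem_bot R).mp hx; simp, by simp⟩
  have htop : f.domain = ⊤ := by
    refine (Submodule.eq_top_iff').mpr fun m ↦ ?_
    obtain ⟨c, J', hc, hmc, hJ, hN'⟩ := hfJ.exists_countable_extension m
    obtain ⟨a, ha⟩ := hc.exists_eq_range ⟨m, hmc⟩
    have hle : f.domain ≤ f.domain ⊔ Submodule.span R c := le_sup_left
    have hcle : Submodule.span R c ≤ f.domain ⊔ Submodule.span R c := le_sup_right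
    have hac (n : ℕ) : a n ∈ f.domain ⊔ Submodule.span R c :=
      hcle (Submodule.subset_span (ha ▸ Set.mem_range_self n))
    have hproj : Module.Projective R
        (↥(f.domain ⊔ Submodule.span R c) ⧸ f.domain.submoduleOf _) := by
      refine .of_tensorProduct_of_span_range (S := S)
        (fun n ↦ (f.domain.submoduleOf _).mkQ ⟨a n, hac n⟩) ?_
        (hfJ.projective_quotient hi hN' hle)
      rw [eq_top_iff]
      rintro y -
      obtain ⟨⟨y, hy⟩, rfl⟩ := Submodule.mkQ_surjective _ y
      obtain ⟨b, hb, z, hz, rfl⟩ := Submodule.mem_sup.mp hy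
      have : (f.domain.submoduleOf (f.domain ⊔ Submodule.span R c)).mkQ ⟨b + z, hy⟩ =
          (f.domain.submoduleOf _).mkQ ⟨z, hcle hz⟩ := by
        refine (Submodule.Quotient.eq _).mpr ?_
        simpa [Submodule.submoduleOf] using hb
      rw [this]
      have hcW : Submodule.span R c ≤ ((Submodule.span R (Set.range fun n ↦
          (f.domain.submoduleOf (f.domain ⊔ Submodule.span R c)).mkQ ⟨a n, hac n⟩)).comap
          (f.domain.submoduleOf _).mkQ).map (f.domain ⊔ Submodule.span R c).subtype := by
        refine Submodule.span_le.mpr fun x hx ↦ ?_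
        obtain ⟨n, rfl⟩ : x ∈ Set.range a := ha ▸ hx
        exact ⟨⟨a n, hac n⟩, Submodule.subset_span ⟨n, rfl⟩, rfl⟩
      obtain ⟨z', hz', rfl⟩ := hcW hz
      exact hz'
    obtain ⟨f', hf'N, hff', hf'⟩ := exists_linearPMap_extension p hp f hf hle hproj
    have := (hmax (y := (f', J')) ⟨hf', hf'N ▸ hN'⟩ ⟨hff', hJ⟩).1.1
    exact this (hf'N ▸ hcle (Submodule.subset_span hmc))
  refine .of_split (f.toFun ∘ₗ (LinearEquiv.ofTop _ htop).symm.toLinearMap) p ?_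
  ext m
  exact hf _

/-! ### Descent along finite covers by basic opens. -/

/-- Over `A`, and so over `R`, `M` is a retract of a direct sum of copies of `A`. -/
theorem Module.Projective.of_isScalarTower {R A M : Type*} [CommRing R] [CommRing A] [Algebra R A]
    [AddCommGroup M] [Module R M] [Module A M] [IsScalarTower R A M] [Module.Projective R A]
    [h : Module.Projective A M] : Module.Projective R M := by
  classical
  obtain ⟨s, hs⟩ := Module.projective_def.mp h
  have : Module.Projective R (M →₀ A) := .of_equiv' (finsuppLequivDFinsupp R).symm
  exact .of_split (s.restrictScalars R) ((Finsupp.linearCombination A id).restrictScalars R)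
    (LinearMap.ext hs)

/-- If `A i ⊗ M` is projective over `A i` for finitely many algebras `A i`, then `(∏ A i) ⊗ M` is
projective over `∏ A i`. -/
theorem Module.Projective.pi_tensorProduct {R M ι : Type*} [CommRing R] [AddCommGroup M]
    [Module R M] [Finite ι] (A : ι → Type*) [∀ i, CommRing (A i)] [∀ i, Algebra R (A i)]
    (h : ∀ i, Module.Projective (A i) (A i ⊗[R] M)) :
    Module.Projective (Π i, A i) ((Π i, A i) ⊗[R] M) := by
  classical
  have := Fintype.ofFinite ι
  let (i : ι) : Algebra (Π i, A i) (A i) := (Pi.evalRingHom A i).toAlgebra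
  have (i : ι) : IsScalarTower R (Π i, A i) (A i) := .of_algebraMap_eq fun _ ↦ rfl
  let pr (i : ι) : (Π i, A i) →ₗ[Π i, A i] A i := Algebra.linearMap _ _
  let inc (i : ι) : A i →ₗ[Π i, A i] (Π i, A i) :=
    { toFun := Pi.single i
      map_add' := Pi.single_add i
      map_smul' := fun c x ↦ by
        ext j
        by_cases hj : j = i
        · subst hj
          simp [Algebra.smul_def, RingHom.algebraMap_toAlgebra]
        · simp [hj] }
  have hA (i : ι) : Module.Projective (Π i, A i) (A i) :=
    .of_split (inc i) (pr i) (by ext; simp [inc, pr, RingHom.algebraMap_toAlgebra])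
  have hQ (i : ι) : Module.Projective (Π i, A i) (A i ⊗[R] M) :=
    .of_isScalarTower (A := A i)
  refine .of_split (M := Π₀ i, A i ⊗[R] M)
    (∑ i, DFinsupp.lsingle i ∘ₗ
      TensorProduct.AlgebraTensorModule.map (pr i) (LinearMap.id (M := M)))
    (DFinsupp.lsum ℕ fun i ↦
      TensorProduct.AlgebraTensorModule.map (inc i) (LinearMap.id (M := M))) ?_
  ext m
  simp [inc, pr, RingHom.algebraMap_toAlgebra, ← TensorProduct.sum_tmul]
  exact congr($(Finset.univ_sum_single (1 : Π i, A i)) ⊗ₜ m)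

/-- A finite product of localizations `R[1 / f]`, such that the elements `f` generate the unit
ideal, is faithfully flat. -/
theorem Module.FaithfullyFlat.pi_localizationAway {R ι : Type*} [CommRing R] [Finite ι]
    (f : ι → R) (hf : Ideal.span (Set.range f) = ⊤) (A : ι → Type*) [∀ i, CommRing (A i)]
    [∀ i, Algebra R (A i)] [∀ i, IsLocalization.Away (f i) (A i)] :
    Module.FaithfullyFlat R (Π i, A i) := by
  classical
  have := Fintype.ofFinite ι
  have (i : ι) : Module.Flat R (A i) := IsLocalization.flat _ (Submonoid.powers (f i))
  have : Module.Flat R (Π i, A i) :=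
    .of_linearEquiv (DFinsupp.linearEquivFunOnFintype (R := R) (M := A)).symm
  refine .of_comap_surjective fun P ↦ ?_
  obtain ⟨i, hi⟩ : ∃ i, f i ∉ P.asIdeal := by
    by_contra! h
    refine P.2.ne_top (top_le_iff.mp (hf ▸ Ideal.span_le.mpr ?_))
    rintro _ ⟨i, rfl⟩
    exact h i
  have hP : P ∈ Set.range (PrimeSpectrum.comap (algebraMap R (A i))) := by
    rw [PrimeSpectrum.localization_away_comap_range (A i) (f i)]
    exact hi
  obtain ⟨Q, rfl⟩ := hP
  refine ⟨PrimeSpectrum.comap (Pi.evalRingHom A i) Q, ?_⟩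
  rw [← PrimeSpectrum.comap_comp_apply]
  rfl

/-- Projectivity of modules can be checked on a finite cover by basic open sets. -/
theorem Module.Projective.of_localizationAway_span {R M ι : Type*} [CommRing R] [AddCommGroup M]
    [Module R M] [Finite ι] (f : ι → R) (hf : Ideal.span (Set.range f) = ⊤)
    (A : ι → Type*) [∀ i, CommRing (A i)] [∀ i, Algebra R (A i)]
    [∀ i, IsLocalization.Away (f i) (A i)] (N : ι → Type*) [∀ i, AddCommGroup (N i)]
    [∀ i, Module R (N i)] [∀ i, Module (A i) (N i)] [∀ i, IsScalarTower R (A i) (N i)]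
    (g : ∀ i, M →ₗ[R] N i) [∀ i, IsLocalizedModule.Away (f i) (g i)]
    (h : ∀ i, Module.Projective (A i) (N i)) : Module.Projective R M := by
  have := Module.FaithfullyFlat.pi_localizationAway f hf A
  refine .of_tensorProduct_of_faithfullyFlat (S := Π i, A i) (.pi_tensorProduct A fun i ↦ ?_)
  exact .of_equiv' (IsLocalizedModule.isBaseChange (.powers (f i)) (A i) (g i)).equiv.symm

/-! ### Sections of quasi-coherent sheaves over affine opens. -/

namespace AlgebraicGeometry

open CategoryTheory Opposite

variable {X : Scheme.{u}} {U : X.Opens}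

theorem IsAffineOpen.fromSpec_image_le (hU : IsAffineOpen U) (V : (Spec Γ(X, U)).Opens) :
    hU.fromSpec ''ᵁ V ≤ U :=
  (Scheme.Hom.image_le_opensRange _ _).trans hU.opensRange_fromSpec.le

/-- This matches scalars acting through `Spec Γ(X, U)` with scalars restricted inside `X`. -/
theorem IsAffineOpen.fromSpec_appIso_inv (hU : IsAffineOpen U) (V : (Spec Γ(X, U)).Opens)
    (r : Γ(X, U)) :
    (hU.fromSpec.appIso V).inv ((Spec Γ(X, U)).presheaf.map V.leTop.op
      ((Scheme.ΓSpecIso Γ(X, U)).inv r)) =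
      X.presheaf.map (homOfLE (hU.fromSpec_image_le V)).op r := by
  have e : V ≤ hU.fromSpec ⁻¹ᵁ U := by simp
  have h : (Scheme.ΓSpecIso Γ(X, U)).inv ≫ (Spec Γ(X, U)).presheaf.map V.leTop.op =
      hU.fromSpec.appLE U V e := by
    rw [Scheme.Hom.appLE, hU.fromSpec_app_self, Category.assoc, ← Functor.map_comp]
    rfl
  rw [← Scheme.Hom.appLE_appIso_inv _ e, ← h]
  rfl

namespace Scheme.Modules

theorem map_homOfLE_map_homOfLE (M : X.Modules) {U V W : X.Opens} (h₁ : W ≤ V) (h₂ : V ≤ U)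
    (x : Γ(M, U)) :
    M.presheaf.map (homOfLE h₁).op (M.presheaf.map (homOfLE h₂).op x) =
      M.presheaf.map (homOfLE (h₁.trans h₂)).op x := by
  rw [← ConcreteCategory.comp_apply, ← Functor.map_comp]
  rfl

theorem map_homOfLE_self (M : X.Modules) (h : U ≤ U) (x : Γ(M, U)) :
    M.presheaf.map (homOfLE h).op x = x :=
  congr($(M.presheaf.map_id (op U)) x)

/-- The restriction of `M` to an affine open `U`, as a module over `Spec Γ(X, U)`: the scalar
action of `Γ(X, U)` on sections. -/
theorem smul_restrict_fromSpec (M : X.Modules) (hU : IsAffineOpen U)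
    (V : (Spec Γ(X, U)).Opens) (r : Γ(X, U)) (x : Γ(M, hU.fromSpec ''ᵁ V)) :
    (r • (show Γ(M.restrict hU.fromSpec, V) from x) : Γ(M.restrict hU.fromSpec, V)) =
      (X.presheaf.map (homOfLE (hU.fromSpec_image_le V)).op r • x :
        Γ(M, hU.fromSpec ''ᵁ V)) := by
  rw [← hU.fromSpec_appIso_inv]
  rfl

/-- Sections of `M` over `D(f)`, as a module over the sections over `U`. -/
@[reducible]
noncomputable def moduleBasicOpen (M : X.Modules) (f : Γ(X, U)) :
    Module Γ(X, U) Γ(M, X.basicOpen f) :=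
  Module.compHom _ (algebraMap Γ(X, U) Γ(X, X.basicOpen f))

attribute [local instance] moduleBasicOpen

/-- The restriction of sections of `M` to `D(f)`. -/
noncomputable def restrictBasicOpen (M : X.Modules) (f : Γ(X, U)) :
    Γ(M, U) →ₗ[Γ(X, U)] Γ(M, X.basicOpen f) where
  toFun := M.presheaf.map (homOfLE (X.basicOpen_le f)).op
  map_add' := map_add _
  map_smul' r x := M.map_smul (homOfLE (X.basicOpen_le f)) r x

/-- On `Spec Γ(X, U)` a quasi-coherent sheaf is the tilde of its global sections; the localization
property is transported along `fromSpec`. -/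
theorem isLocalizedModule_restrictBasicOpen (M : X.Modules) [M.IsQuasicoherent]
    (hU : IsAffineOpen U) (f : Γ(X, U)) :
    IsLocalizedModule.Away f (M.restrictBasicOpen f) := by
  have := hU.isLocalization_basicOpen f
  have hloc := (isIso_fromTildeΓ_iff_isLocalizing (M.restrict hU.fromSpec)).mp inferInstance f
  -- The images of `D` and `⊤` equal `D(f)` and `U` only propositionally, so sections are moved by
  -- restriction along these equalities.
  obtain ⟨D, hDf⟩ : ∃ D : (Spec Γ(X, U)).Opens, D = PrimeSpectrum.basicOpen f := ⟨_, rfl⟩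
  have hD : hU.fromSpec ''ᵁ D = X.basicOpen f := hDf ▸ hU.fromSpec_image_basicOpen f
  have hT : hU.fromSpec ''ᵁ ⊤ = U := by simp
  have hle := Scheme.Hom.image_mono hU.fromSpec (le_top (a := D))
  have hsurj (y : Γ(M, hU.fromSpec ''ᵁ D)) :
      ∃ (n : ℕ) (t : Γ(M, hU.fromSpec ''ᵁ ⊤)), M.presheaf.map (homOfLE hle).op t =
        X.presheaf.map (homOfLE (hU.fromSpec_image_le D)).op (f ^ n) • y := by
    subst hDf
    obtain ⟨⟨t, ⟨_, n, rfl⟩⟩, ht⟩ := hloc.surj (y := y)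
    exact ⟨n, t, ht.symm.trans (M.smul_restrict_fromSpec hU _ (f ^ n) y)⟩
  have hinj (y : Γ(M, hU.fromSpec ''ᵁ ⊤)) (hy : M.presheaf.map (homOfLE hle).op y = 0) :
      ∃ n : ℕ, X.presheaf.map (homOfLE (hU.fromSpec_image_le ⊤)).op (f ^ n) • y = 0 := by
    subst hDf
    obtain ⟨⟨_, n, rfl⟩, hn⟩ := (IsLocalizedModule.eq_zero_iff (.powers f)
      ((modulesSpecToSheaf.obj (M.restrict hU.fromSpec)).obj.map
        (PrimeSpectrum.basicOpen f).leTop.op).hom).mp hy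
    exact ⟨n, (M.smul_restrict_fromSpec hU _ (f ^ n) y).symm.trans hn⟩
  refine IsLocalizedModule.Away.mk_of_addCommGroup ?_ (fun x ↦ ?_) (fun x hx ↦ ?_)
  · have h := (IsLocalization.Away.algebraMap_isUnit (S := Γ(X, X.basicOpen f)) f).map
      (algebraMap Γ(X, X.basicOpen f) (Module.End Γ(X, X.basicOpen f) Γ(M, X.basicOpen f)))
    rw [Module.End.isUnit_iff] at h ⊢
    exact h
  · obtain ⟨n, t, ht⟩ := hsurj (M.presheaf.map (homOfLE hD.le).op x)
    refine ⟨n, M.presheaf.map (homOfLE hT.ge).op t, ?_⟩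
    have := congr(M.presheaf.map (homOfLE hD.ge).op $ht)
    rw [M.map_smul, M.map_homOfLE_map_homOfLE, M.map_homOfLE_map_homOfLE,
      M.map_homOfLE_self, ← ConcreteCategory.comp_apply, ← Functor.map_comp, ← op_comp,
      homOfLE_comp] at this
    refine this.symm.trans (M.map_homOfLE_map_homOfLE _ _ _).symm
  · obtain ⟨n, hn⟩ := hinj (M.presheaf.map (homOfLE hT.le).op x) (by
      have := congr(M.presheaf.map (homOfLE hD.le).op $hx)
      rw [map_zero] at this
      rw [← this, M.map_homOfLE_map_homOfLE]
      exact (M.map_homOfLE_map_homOfLE _ _ _).symm)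
    refine ⟨n, ?_⟩
    have := congr(M.presheaf.map (homOfLE hT.ge).op $hn)
    rwa [M.map_smul, M.map_homOfLE_map_homOfLE, M.map_homOfLE_self, map_zero,
      ← ConcreteCategory.comp_apply, ← Functor.map_comp, ← op_comp, homOfLE_comp,
      Subsingleton.elim (homOfLE _) (𝟙 U), op_id, X.presheaf.map_id] at this

instance (M : X.Modules) (f : Γ(X, U)) :
    IsScalarTower Γ(X, U) Γ(X, X.basicOpen f) Γ(M, X.basicOpen f) :=
  .of_algebraMap_smul fun _ _ ↦ rfl

theorem projective_basicOpen (M : X.Modules) [M.IsQuasicoherent] (hU : IsAffineOpen U)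
    (f : Γ(X, U)) [Module.Projective Γ(X, U) Γ(M, U)] :
    Module.Projective Γ(X, X.basicOpen f) Γ(M, X.basicOpen f) := by
  have := hU.isLocalization_basicOpen f
  have := M.isLocalizedModule_restrictBasicOpen hU f
  exact .of_equiv' (IsLocalizedModule.isBaseChange (.powers f) Γ(X, X.basicOpen f)
    (M.restrictBasicOpen f)).equiv

theorem projective_of_span_basicOpen (M : X.Modules) [M.IsQuasicoherent] (hU : IsAffineOpen U)
    (s : Finset Γ(X, U)) (hs : Ideal.span (s : Set Γ(X, U)) = ⊤)
    (h : ∀ f ∈ s, Module.Projective Γ(X, X.basicOpen f) Γ(M, X.basicOpen f)) :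
    Module.Projective Γ(X, U) Γ(M, U) := by
  have (f : s) := hU.isLocalization_basicOpen f.1
  have (f : s) := M.isLocalizedModule_restrictBasicOpen hU f.1
  exact .of_localizationAway_span (fun f : s ↦ f.1) (by simpa using hs)
    (fun f ↦ Γ(X, X.basicOpen f.1)) (fun f ↦ Γ(M, X.basicOpen f.1))
    (fun f ↦ M.restrictBasicOpen f.1) fun f ↦ h f.1 f.2

/-- Affine-locality of projectivity of sections of a quasi-coherent sheaf. -/
theorem projective_of_isAffineOpen_cover (M : X.Modules) [M.IsQuasicoherent] (C : Set X.Opens)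
    (hC : ∀ U ∈ C, IsAffineOpen U) (hcov : sSup C = ⊤)
    (h : ∀ U ∈ C, Module.Projective Γ(X, U) Γ(M, U)) (hU : IsAffineOpen U) :
    Module.Projective Γ(X, U) Γ(M, U) := by
  -- This is the affine communication lemma: it needs passage to basic opens and descent from
  -- finitely many generating the unit ideal.
  refine of_affine_open_cover (P := fun V ↦ Module.Projective Γ(X, V) Γ(M, V))
    (fun V : C ↦ ⟨V.1, hC V.1 V.2⟩) (by rw [← hcov, sSup_eq_iSup']) ⟨U, hU⟩
    (fun V f hV ↦ M.projective_basicOpen V.2 f)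
    (fun V s hs hV ↦ M.projective_of_span_basicOpen V.2 s hs fun f hf ↦ hV ⟨f, hf⟩)
    (fun V ↦ h V.1 V.2)

end Scheme.Modules
end AlgebraicGeometry

theorem theorem4p5 :
    -- projectivity ascends along flat ring homomorphisms
    (∀ (R : Type u) (S : Type v) [CommRing R] [CommRing S] [Algebra R S] [Module.Flat R S]
      (M : Type w) [AddCommGroup M] [Module R M],
      Module.Projective R M → Module.Projective S (S ⊗[R] M)) ∧
    -- projectivity descends along faithfully flat ring homomorphisms
    (∀ (R : Type u) (S : Type v) [CommRing R] [CommRing S] [Algebra R S] [Module.FaithfullyFlat R S]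
      (M : Type w) [AddCommGroup M] [Module R M],
      Module.Projective S (S ⊗[R] M) → Module.Projective R M) ∧
    -- being a vector bundle can be checked on any covering by affine opens
    (∀ (X : AlgebraicGeometry.Scheme.{t}) (M : X.Modules), M.IsQuasicoherent →
      ∀ C : Set X.Opens, (∀ U ∈ C, AlgebraicGeometry.IsAffineOpen U) → sSup C = ⊤ →
        (IsVectorBundle M ↔ ∀ U ∈ C, Module.Projective Γ(X, U) Γ(M, U))) := by
  refine ⟨fun R S _ _ _ _ M _ _ h ↦ inferInstance,
    fun R S _ _ _ _ M _ _ h ↦ .of_tensorProduct_of_faithfullyFlat h,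
    fun X M hM C hC hcov ↦ ⟨fun h U hU ↦ h.2 U (hC U hU), fun h ↦ ⟨hM, fun U hU ↦ ?_⟩⟩⟩
  exact M.projective_of_isAffineOpen_cover C hC hcov h hU
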